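/- Let $n,s\ge 0$ and $m\ge 1$ be integers. Graphs are finite multigraphs (loops and parallel edges allowed) with $s$ labelled legs, i.e. $s$ labelled base points on the vertices, several of which may lie on the same vertex. A graph is \emph{admissible} if it is connected, stays connected when any single internal edge is removed, and has only vertices of valency at least $3$ (loops count twice, legs once). Its rank is its first Betti number, $E(G)$ is its set of internal edges, and an $m$-coloring is an arbitrary map $c:E(G)\to\{1,\dots,m\}$. Let $\mathcal{MCG}^m_{n,s}$ be the moduli space of $m$-colored admissible metric graphs of rank $n$ with $s$ legs, $\mathcal{MG}_{n,s}$ the moduli space of uncolored ones, and $X^m_s:=\mathcal{MCG}^m_{1,s}$. The rational cubical chain group $C_k(\mathcal{MCG}^m_{n,s})$ is the $\mathbb Q$-vector space generated by the cubes $(G,F,c)$, where $G$ is an admissible graph of rank $n$ with $s$ legs, $c$ is an $m$-coloring of $G$, and $F$ is a forest in $G$ with an ordering $e_1,\dots,e_k$ of its $k$ edges, subject to the relations that isomorphic cubes (by isomorphisms preserving legs, colors and the ordered forest) are equal and that reordering the edges of $F$ by a permutation multiplies the cube by its sign. The boundary operator is $$\partial(G,F,c)=\sum_{i=1}^k(-1)^{i-1}\Big((G,F\setminus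 e_i,c)-(G/e_i,F/e_i,c|_{E(G)\setminus\{e_i\}})\Big).$$ The complex $C_*(\mathcal{MG}_{n,s})$ is defined in the same way without colorings. Write $H_*(\,\cdot\,;\mathbb Q)$ for the homology of these rational cubical chain complexes. Consider the chain maps $$f^{(m)}:C_*(\mathcal{MCG}^m_{n,s})\to C_*(\mathcal{MG}_{n,s}),\quad (G,F,c)\mapsto (G,F),$$ $$c^{(m)}:C_*(\mathcal{MG}_{n,s})\to C_*(\mathcal{MCG}^m_{n,s}),\quad (G,F)\mapsto \sum_{c:E(G)\to\{1,\dots,m\}}\frac{1}{m^{|E(G)|}}\,(G,F,c).$$ Then the induced maps on homology satisfy $f^{(m)}_*\circ c^{(m)}_*=\mathrm{id}$ on $H_k(\mathcal{MG}_{n,s};\mathbb Q)$ for every $k\ge 0$. Hence $f^{(m)}_*$ is surjective and $c^{(m)}_*$ is injective. In particular $\dim_{\mathbb Q} H_k(X^1_s;\mathbb Q)\le\dim_{\mathbb Q} H_k(X^m_s;\mathbb Q)$ for all $k\ge 0$. -/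

import Mathlib

open CategoryTheory

/-- A finite multigraph with `s` labelled legs: `ends e` is the unordered pair of end points of the
internal edge `e` (a loop if they coincide), and `leg i` is the vertex carrying the `i`-th leg
(several legs may sit at the same vertex). -/
structure LegGraph (s : ℕ) where
  V : Type
  E : Type
  finV : Finite V
  finE : Finite E
  ends : E → Sym2 V
  leg : Fin s → V

attribute [instance] LegGraph.finV LegGraph.finE

namespace LegGraph

variable {s : ℕ} (G : LegGraph s)

/-- `G.adj S u v`: some edge of `S` has end points `u` and `v`. -/
def adj (S : Set G.E) (u v : G.V) : Prop := ∃ e ∈ S, G.ends e = s(u, v)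

/-- The set of connected components of the subgraph with all vertices of `G` and edge set `S`. -/
abbrev Comp (S : Set G.E) : Type := Quot (G.adj S)

/-- The number of connected components of the subgraph with all vertices and edge set `S`. -/
noncomputable def numComp (S : Set G.E) : ℕ := Nat.card (G.Comp S)

/-- The first Betti number (number of independent loops) of the subgraph with edge set `S`. -/
noncomputable def betti (S : Set G.E) : ℤ := (S.ncard : ℤ) - Nat.card G.V + G.numComp S

/-- The rank (loop number) of `G`. -/
noncomputable def rank : ℤ := G.betti Set.univ

/-- The valency of a vertex: the number of half-edges and legs at it, so loops count twice. -/
noncomputable def valency (v : G.V) : ℕ :=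
  {e | v ∈ G.ends e}.ncard + {e | G.ends e = s(v, v)}.ncard + {i | G.leg i = v}.ncard

/-- `G` is connected and stays connected when any one internal edge is removed (1PI), and all its
vertices have valency at least three. -/
structure Admissible : Prop where
  connected : G.numComp Set.univ = 1
  bridgeless : ∀ e : G.E, G.numComp {e}ᶜ = 1
  three_le_valency : ∀ v : G.V, 3 ≤ G.valency v

/-- The edge set `S` is a forest: it contains no loops. -/
def IsForest (S : Set G.E) : Prop := G.betti S = 0

/-- The graph `G / e`: the edge `e` is removed and its end points are identified. -/
abbrev contract (e : G.E) : LegGraph s where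
  V := G.Comp {e}
  E := {a : G.E // a ≠ e}
  finV := inferInstance
  finE := inferInstance
  ends a := (G.ends a.1).map (Quot.mk _)
  leg i := Quot.mk _ (G.leg i)

/-! Helper facts on forests and contractions. -/

lemma numComp_empty : G.numComp ∅ = Nat.card G.V := by
  refine Nat.card_congr ⟨Quot.lift id ?_, Quot.mk _, ?_, fun _ => rfl⟩
  · rintro a b ⟨e, he, -⟩
    exact absurd he (Set.notMem_empty e)
  · rintro ⟨v⟩
    rfl

lemma betti_empty : G.betti ∅ = 0 := by
  simp [betti, numComp_empty]

lemma comp_sound {S : Set G.E} {e : G.E} (he : e ∈ S) {u v : G.V} (h : G.ends e = s(u, v)) :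
    (Quot.mk _ u : G.Comp S) = Quot.mk _ v := Quot.sound ⟨e, he, h⟩

lemma numComp_le_insert (S : Set G.E) (e : G.E) :
    G.numComp S ≤ G.numComp (insert e S) + 1 := by
  classical
  obtain ⟨a, b, hab⟩ : ∃ a b, G.ends e = s(a, b) := by
    induction h : G.ends e using Sym2.ind with
    | _ a b => exact ⟨a, b, rfl⟩
  let A : G.Comp S := Quot.mk _ a
  let B : G.Comp S := Quot.mk _ b
  let g : G.V → G.Comp S := fun v => if (Quot.mk _ v : G.Comp S) = B then A else Quot.mk _ v
  have hg : ∀ u v, G.adj (insert e S) u v → g u = g v := by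
    rintro u v ⟨e', he', h⟩
    rcases Set.mem_insert_iff.1 he' with rfl | he'
    · rw [hab] at h
      rcases Sym2.eq_iff.1 h with ⟨rfl, rfl⟩ | ⟨rfl, rfl⟩
      · simp only [g, A, B, if_true]
        split_ifs <;> rfl
      · simp only [g, A, B, if_true]
        split_ifs <;> rfl
    · have := G.comp_sound he' h
      simp [g, this]
  let h : Option (G.Comp (insert e S)) → G.Comp S := fun o => o.elim B (Quot.lift g hg)
  have hs : Function.Surjective h := by
    rintro ⟨v⟩
    by_cases hv : (Quot.mk _ v : G.Comp S) = B
    · exact ⟨none, hv.symm⟩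
    · exact ⟨some (Quot.mk _ v), if_neg hv⟩
  have := Nat.card_le_card_of_surjective h hs
  rwa [Finite.card_option] at this

lemma betti_le_insert (S : Set G.E) (e : G.E) : G.betti S ≤ G.betti (insert e S) := by
  by_cases he : e ∈ S
  · rw [Set.insert_eq_of_mem he]
  · have h1 := G.numComp_le_insert S e
    have h2 := Set.ncard_insert_of_notMem he (Set.toFinite S)
    unfold betti
    omega

lemma betti_mono {S T : Set G.E} (h : S ⊆ T) : G.betti S ≤ G.betti T := by
  have key : ∀ U : Set G.E, U.Finite → G.betti S ≤ G.betti (S ∪ U) := by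
    intro U hU
    induction U, hU using Set.Finite.induction_on with
    | empty => simp
    | insert _ _ ih =>
      rw [Set.union_insert]
      exact ih.trans (G.betti_le_insert _ _)
  have := key T (Set.toFinite T)
  rwa [Set.union_eq_self_of_subset_left h] at this

lemma IsForest.subset {G : LegGraph s} {S T : Set G.E} (hT : G.IsForest T) (h : S ⊆ T) :
    G.IsForest S := by
  have h1 := G.betti_mono h
  have h2 := G.betti_mono (Set.empty_subset S)
  rw [betti_empty] at h2
  unfold IsForest at *
  omega

lemma contract_numComp (e : G.E) (S : Set (G.contract e).E) :
    (G.contract e).numComp S = G.numComp (insert e (Subtype.val '' S)) := by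
  refine Nat.card_congr ⟨?_, ?_, ?_, ?_⟩
  · refine Quot.lift (Quot.lift (Quot.mk _) ?_) ?_
    · rintro u v ⟨e', rfl, h⟩
      exact G.comp_sound (Set.mem_insert _ _) h
    · rintro ⟨u⟩ ⟨v⟩ ⟨a, ha, h⟩
      change (G.ends a.1).map (Quot.mk _) = _ at h
      obtain ⟨u', v', huv⟩ : ∃ u v, G.ends a.1 = s(u, v) := by
        induction h : G.ends a.1 using Sym2.ind with
        | _ a b => exact ⟨a, b, rfl⟩
      have h3 := G.comp_sound (S := insert e (Subtype.val '' S))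
        (Set.mem_insert_of_mem _ ⟨a, ha, rfl⟩) huv
      have hl : ∀ p q : G.V, (Quot.mk (G.adj {e}) p) = Quot.mk _ q →
          (Quot.mk _ p : G.Comp (insert e (Subtype.val '' S))) = Quot.mk _ q := by
        intro p q hpq
        refine congrArg (Quot.lift (r := G.adj {e})
          (Quot.mk (G.adj (insert e (Subtype.val '' S)))) ?_) hpq
        rintro u v ⟨e', rfl, h'⟩
        exact G.comp_sound (Set.mem_insert _ _) h'
      rw [huv, Sym2.map_mk] at h
      rcases Sym2.eq_iff.1 h with ⟨h1, h2⟩ | ⟨h1, h2⟩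
      · exact (hl _ _ h1).symm.trans (h3.trans (hl _ _ h2))
      · exact (hl _ _ h2).symm.trans (h3.symm.trans (hl _ _ h1))
  · refine Quot.lift (fun v => Quot.mk _ (Quot.mk _ v)) ?_
    rintro u v ⟨e', he', h⟩
    rcases Set.mem_insert_iff.1 he' with rfl | ⟨a, ha, rfl⟩
    · exact congrArg (Quot.mk _) (G.comp_sound (Set.mem_singleton _) h)
    · refine Quot.sound ⟨a, ha, ?_⟩
      change (G.ends a.1).map (Quot.mk _) = _
      rw [h, Sym2.map_mk]
  · rintro ⟨⟨v⟩⟩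
    rfl
  · rintro ⟨v⟩
    rfl

lemma card_contract {e : G.E} (he : G.IsForest {e}) :
    (Nat.card (G.contract e).V : ℤ) = Nat.card G.V - 1 := by
  have h : Nat.card (G.contract e).V = G.numComp {e} := rfl
  have h2 : G.betti {e} = 0 := he
  unfold betti at h2
  rw [Set.ncard_singleton] at h2
  omega

lemma contract_betti {e : G.E} (he : G.IsForest {e}) (S : Set (G.contract e).E) :
    (G.contract e).betti S = G.betti (insert e (Subtype.val '' S)) := by
  have h1 := G.card_contract he
  have h2 := G.contract_numComp e S
  have h3 : (insert e (Subtype.val '' S)).ncard = S.ncard + 1 := by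
    rw [Set.ncard_insert_of_notMem _ (Set.toFinite _),
      Set.ncard_image_of_injective _ Subtype.val_injective]
    rintro ⟨a, -, h⟩
    exact a.2 h
  unfold betti
  rw [h1, h2, h3]
  push_cast
  ring

lemma contract_rank {e : G.E} (he : G.IsForest {e}) : (G.contract e).rank = G.rank := by
  unfold rank
  rw [G.contract_betti he]
  congr 1
  ext a
  by_cases h : a = e
  · simp [h]
  · exact ⟨fun _ => trivial, fun _ => Set.mem_insert_of_mem _ ⟨⟨a, h⟩, trivial, rfl⟩⟩

lemma not_loop {e : G.E} (he : G.IsForest {e}) (v : G.V) : G.ends e ≠ s(v, v) := by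
  intro h
  have h1 : G.numComp {e} = Nat.card G.V := by
    refine Nat.card_congr ⟨Quot.lift id ?_, Quot.mk _, ?_, fun _ => rfl⟩
    · rintro a b ⟨e', rfl, h'⟩
      rw [h] at h'
      rcases Sym2.eq_iff.1 h' with ⟨rfl, rfl⟩ | ⟨rfl, rfl⟩ <;> rfl
    · rintro ⟨v⟩
      rfl
  have h2 : G.betti {e} = 0 := he
  unfold betti at h2
  rw [Set.ncard_singleton] at h2
  omega

lemma valency_contract {e : G.E} (he : G.IsForest {e}) (hG : ∀ v, 3 ≤ G.valency v)
    (w : (G.contract e).V) : 3 ≤ (G.contract e).valency w := by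
  classical
  -- for every vertex in the class `w`, its half-edges other than those of `e` survive
  have hE : ∀ (v : G.V) (a : G.E) (ha : a ≠ e), v ∈ G.ends a →
      (Quot.mk _ v : G.Comp {e}) ∈ (G.contract e).ends ⟨a, ha⟩ := fun v a ha h =>
    Sym2.mem_map.2 ⟨v, h, rfl⟩
  have hfin : ∀ {α : Type} [Finite α] (S : Set α), S.Finite := fun S => Set.toFinite S
  obtain ⟨a, b, hab⟩ : ∃ a b, G.ends e = s(a, b) := by
    induction h : G.ends e using Sym2.ind with
    | _ a b => exact ⟨a, b, rfl⟩
  have hne : a ≠ b := by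
    rintro rfl
    exact G.not_loop he a hab
  have hAB : (Quot.mk _ a : G.Comp {e}) = Quot.mk _ b := G.comp_sound (Set.mem_singleton _) hab
  have key : ∀ v, v ≠ a → v ≠ b → G.valency v ≤ (G.contract e).valency (Quot.mk _ v) := by
    intro v hva hvb
    have hv : ∀ a, v ∈ G.ends a → a ≠ e := by
      rintro _ h rfl
      rw [hab, Sym2.mem_iff] at h
      tauto
    unfold valency
    refine add_le_add (add_le_add ?_ ?_) ?_
    · rw [← Set.ncard_image_of_injective {x : (G.contract e).E | _} Subtype.val_injective]
      refine Set.ncard_le_ncard (fun x hx => ?_) (hfin _)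
      exact ⟨⟨x, hv x hx⟩, hE v x _ hx, rfl⟩
    · rw [← Set.ncard_image_of_injective {x : (G.contract e).E | _} Subtype.val_injective]
      refine Set.ncard_le_ncard (fun x hx => ?_) (hfin _)
      have hx' : G.ends x = s(v, v) := hx
      refine ⟨⟨x, hv x (by rw [hx']; exact Sym2.mem_mk_left _ _)⟩, ?_, rfl⟩
      change (G.ends x).map _ = _
      rw [hx', Sym2.map_mk]
    · exact Set.ncard_le_ncard (fun i hi => congrArg (Quot.mk _) hi) (hfin _)
  induction w using Quot.ind with
  | _ v =>
  by_cases hv : v ≠ a ∧ v ≠ b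
  · exact (hG v).trans (key v hv.1 hv.2)
  have hva : (Quot.mk _ v : G.Comp {e}) = Quot.mk _ a := by
    by_cases h : v = a
    · rw [h]
    · have : v = b := by tauto
      rw [this, hAB]
  rw [hva]
  let I : G.V → Set G.E := fun v => {x | v ∈ G.ends x}
  let L : G.V → Set G.E := fun v => {x | G.ends x = s(v, v)}
  let N : G.V → Set (Fin s) := fun v => {i | G.leg i = v}
  have ha : 3 ≤ (I a).ncard + (L a).ncard + (N a).ncard := hG a
  have hb : 3 ≤ (I b).ncard + (L b).ncard + (N b).ncard := hG b
  have h1 : ((I a ∪ I b) \ {e}).ncard ≤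
      {x : (G.contract e).E | (Quot.mk _ a : G.Comp {e}) ∈ (G.contract e).ends x}.ncard := by
    rw [← Set.ncard_image_of_injective {x : (G.contract e).E | _} Subtype.val_injective]
    refine Set.ncard_le_ncard ?_ (hfin _)
    rintro x ⟨hx | hx, hxe⟩
    · exact ⟨⟨x, hxe⟩, hE a x _ hx, rfl⟩
    · exact ⟨⟨x, hxe⟩, by
        have := hE b x hxe hx
        rw [← hAB] at this
        exact this, rfl⟩
  have h2 : (((I a ∩ I b) \ {e}) ∪ (L a ∪ L b)).ncard ≤
      {x : (G.contract e).E | (G.contract e).ends x =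
        s((Quot.mk _ a : G.Comp {e}), Quot.mk _ a)}.ncard := by
    rw [← Set.ncard_image_of_injective {x : (G.contract e).E | _} Subtype.val_injective]
    refine Set.ncard_le_ncard ?_ (hfin _)
    have hl : ∀ v, G.ends e ≠ s(v, v) := G.not_loop he
    rintro x (⟨⟨hx, hx'⟩, hxe⟩ | hx | hx)
    · refine ⟨⟨x, hxe⟩, ?_, rfl⟩
      have : G.ends x = s(a, b) := ((Sym2.mem_and_mem_iff hne).1 ⟨hx, hx'⟩)
      change (G.ends x).map _ = _
      rw [this, Sym2.map_mk]
      change s(_, (Quot.mk _ b : G.Comp {e})) = _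
      rw [← hAB]
    · have hx' : G.ends x = s(a, a) := hx
      refine ⟨⟨x, by rintro rfl; exact hl _ hx'⟩, ?_, rfl⟩
      change (G.ends x).map _ = _
      rw [hx', Sym2.map_mk]
    · have hx' : G.ends x = s(b, b) := hx
      refine ⟨⟨x, by rintro rfl; exact hl _ hx'⟩, ?_, rfl⟩
      change (G.ends x).map _ = _
      rw [hx', Sym2.map_mk]
      change s((Quot.mk _ b : G.Comp {e}), (Quot.mk _ b : G.Comp {e})) = _
      rw [← hAB]
  have h3 : (N a ∪ N b).ncard ≤
      {i | (G.contract e).leg i = (Quot.mk _ a : G.Comp {e})}.ncard := by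
    refine Set.ncard_le_ncard ?_ (hfin _)
    rintro i (hi | hi)
    · exact congrArg (Quot.mk _) hi
    · exact (congrArg (Quot.mk _) hi).trans hAB.symm
  have hIL : ∀ x, x ∈ I a ∩ I b → x ∉ L a ∪ L b := by
    rintro x ⟨hx, hx'⟩ h
    have h4 : G.ends x = s(a, b) := ((Sym2.mem_and_mem_iff hne).1 ⟨hx, hx'⟩)
    rcases h with h | h
    · exact hne (by
        have h5 : G.ends x = s(a, a) := h
        rw [h4, Sym2.eq_iff] at h5
        tauto)
    · exact hne (by
        have h5 : G.ends x = s(b, b) := h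
        rw [h4, Sym2.eq_iff] at h5
        tauto)
  have d1 := Set.ncard_union_eq (s := (I a ∩ I b) \ {e}) (t := L a ∪ L b)
    (Set.disjoint_left.2 fun x hx => hIL x hx.1) (hfin _) (hfin _)
  have d2 := Set.ncard_union_eq (s := L a) (t := L b)
    (Set.disjoint_left.2 fun x hx hx' => hne (by
      have h5 : G.ends x = s(a, a) := hx
      have h6 : G.ends x = s(b, b) := hx'
      rw [h5, Sym2.eq_iff] at h6
      tauto)) (hfin _) (hfin _)
  have d3 := Set.ncard_union_eq (s := N a) (t := N b)
    (Set.disjoint_left.2 fun x hx hx' => hne (hx.symm.trans hx')) (hfin _) (hfin _)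
  have d4 := Set.ncard_union_add_ncard_inter (I a) (I b) (hfin _) (hfin _)
  have hea : e ∈ I a := by
    change a ∈ G.ends e
    rw [hab]
    exact Sym2.mem_mk_left _ _
  have heb : e ∈ I b := by
    change b ∈ G.ends e
    rw [hab]
    exact Sym2.mem_mk_right _ _
  have d5 := Set.ncard_sdiff_singleton_add_one (s := I a ∪ I b) (a := e) (Or.inl hea) (hfin _)
  have d6 := Set.ncard_sdiff_singleton_add_one (s := I a ∩ I b) (a := e) ⟨hea, heb⟩ (hfin _)
  unfold valency
  omega

lemma contract_admissible {e : G.E} (he : G.IsForest {e}) (hG : G.Admissible) :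
    (G.contract e).Admissible where
  connected := by
    rw [contract_numComp, ← hG.connected]
    congr 1
    ext a
    by_cases h : a = e
    · simp [h]
    · exact ⟨fun _ => trivial, fun _ => Set.mem_insert_of_mem _ ⟨⟨a, h⟩, trivial, rfl⟩⟩
  bridgeless := by
    rintro ⟨a, ha⟩
    rw [contract_numComp, ← hG.bridgeless a]
    congr 1
    ext x
    constructor
    · rintro (rfl | ⟨y, hy, rfl⟩)
      · exact fun h => ha h.symm
      · exact fun h => hy (Subtype.ext h)
    · intro hx
      by_cases h : x = e
      · exact Or.inl h
      · exact Or.inr ⟨⟨x, h⟩, fun h' => hx (congrArg Subtype.val h'), rfl⟩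
  three_le_valency := G.valency_contract he hG.three_le_valency

end LegGraph

/-- A cube `(G, F, c)` of dimension `k`, with an ordering of the edges of the forest `F`: `G` is an
admissible graph of rank `n` with `s` legs, `F 0, …, F (k-1)` are the edges of the forest, and
`col` is a coloring of the edges of `G` by elements of `K`. -/
structure GraphCube (K : Type) (n s k : ℕ) where
  G : LegGraph s
  adm : G.Admissible
  rank_eq : G.rank = n
  F : Fin k → G.E
  inj : Function.Injective F
  forest : G.IsForest (Set.range F)
  col : G.E → K

namespace GraphCube

variable {K : Type} {n s k l : ℕ}

/-- Isomorphism of graphs respecting end points, legs, colors, and the ordered forest. -/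
def Iso (x y : GraphCube K n s k) : Prop :=
  ∃ (φ : x.G.V ≃ y.G.V) (ψ : x.G.E ≃ y.G.E),
    (∀ e, y.G.ends (ψ e) = (x.G.ends e).map φ) ∧ (∀ i, y.G.leg i = φ (x.G.leg i)) ∧
    (∀ j, ψ (x.F j) = y.F j) ∧ (∀ e, y.col (ψ e) = x.col e)

/-- The cube on the same graph whose ordered forest consists of the edges
`F (f 0), …, F (f (k-1))` of the forest of `x`. -/
def sub (x : GraphCube K n s l) (f : Fin k ↪ Fin l) : GraphCube K n s k where
  G := x.G
  adm := x.adm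
  rank_eq := x.rank_eq
  F := x.F ∘ f
  inj := x.inj.comp f.injective
  forest := x.forest.subset (Set.range_comp_subset_range _ _)
  col := x.col

/-- The same cube with the edges of the forest reordered. -/
def reorder (x : GraphCube K n s k) (σ : Equiv.Perm (Fin k)) : GraphCube K n s k :=
  x.sub σ.toEmbedding

/-- The face `(G, F \ e_i, c)`. -/
def del (x : GraphCube K n s (k + 1)) (i : Fin (k + 1)) : GraphCube K n s k :=
  x.sub i.succAboveEmb

/-- The cube `(G / e, F / e, c restricted to E \ {e})`, where `F` lists the other edges of a forest
containing `e`. -/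
def contractAt (G : LegGraph s) (adm : G.Admissible) (rank_eq : G.rank = n) (col : G.E → K)
    (e : G.E) (F : Fin k → G.E) (inj : Function.Injective F) (ne : ∀ j, F j ≠ e)
    (forest : G.IsForest (insert e (Set.range F))) : GraphCube K n s k where
  G := G.contract e
  adm := G.contract_admissible (forest.subset (by simp)) adm
  rank_eq := (G.contract_rank (forest.subset (by simp))).trans rank_eq
  F j := ⟨F j, ne j⟩
  inj _ _ h := inj (congrArg Subtype.val h)
  forest := by
    unfold LegGraph.IsForest
    rw [G.contract_betti (forest.subset (by simp)), ← Set.range_comp]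
    exact forest
  col a := col a.1

/-- The face `(G / e_i, F / e_i, c restricted to E \ {e_i})`. -/
def con (x : GraphCube K n s (k + 1)) (i : Fin (k + 1)) : GraphCube K n s k :=
  contractAt x.G x.adm x.rank_eq x.col (x.F i) (x.F ∘ i.succAbove)
    (x.inj.comp Fin.succAbove_right_injective)
    (fun _ h => Fin.succAbove_ne _ _ (x.inj h))
    (x.forest.subset (Set.insert_subset (Set.mem_range_self _) (Set.range_comp_subset_range _ _)))

/-- The same cube with another coloring, by elements of some type `L`. -/
def recolor {L : Type} (x : GraphCube K n s k) (c : x.G.E → L) : GraphCube L n s k where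
  G := x.G
  adm := x.adm
  rank_eq := x.rank_eq
  F := x.F
  inj := x.inj
  forest := x.forest
  col := c

end GraphCube

/-- Isomorphic cubes are identified, and reordering the forest multiplies by the sign. -/
noncomputable def chainRel (K : Type) (n s k : ℕ) : Submodule ℚ (GraphCube K n s k →₀ ℚ) :=
  Submodule.span ℚ
    ({z | ∃ x y : GraphCube K n s k, x.Iso y ∧ z = Finsupp.single x 1 - Finsupp.single y 1} ∪
     {z | ∃ (x : GraphCube K n s k) (σ : Equiv.Perm (Fin k)),
        z = Finsupp.single (x.reorder σ) 1 - ((Equiv.Perm.sign σ : ℤ) : ℚ) • Finsupp.single x 1})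

/-- The rational cubical `k`-chains: the rational vector space on the oriented cubes `(G, F, c)`
with `F` having `k` edges, up to isomorphism. -/
abbrev CubeChain (K : Type) (n s k : ℕ) : Type 1 :=
  (GraphCube K n s k →₀ ℚ) ⧸ chainRel K n s k

namespace CubeChain

variable {K : Type} {n s k : ℕ}

/-- The chain given by a single cube. -/
noncomputable def mk (x : GraphCube K n s k) : CubeChain K n s k :=
  (chainRel K n s k).mkQ (Finsupp.single x 1)

lemma mk_eq_of_iso {x y : GraphCube K n s k} (h : x.Iso y) : mk x = mk y := by
  unfold mk
  rw [← sub_eq_zero, ← map_sub, Submodule.mkQ_apply, Submodule.Quotient.mk_eq_zero]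
  exact Submodule.subset_span (Or.inl ⟨x, y, h, rfl⟩)

lemma mk_reorder (x : GraphCube K n s k) (σ : Equiv.Perm (Fin k)) :
    mk (x.reorder σ) = ((Equiv.Perm.sign σ : ℤ) : ℚ) • mk x := by
  unfold mk
  rw [← sub_eq_zero, ← map_smul, ← map_sub, Submodule.mkQ_apply, Submodule.Quotient.mk_eq_zero]
  exact Submodule.subset_span (Or.inr ⟨x, σ, rfl⟩)

/-- A function on cubes that is compatible with isomorphisms and orientations extends uniquely to
a linear map on chains. -/
noncomputable def lift {M : Type*} [AddCommGroup M] [Module ℚ M] (g : GraphCube K n s k → M)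
    (h1 : ∀ x y, x.Iso y → g x = g y)
    (h2 : ∀ x σ, g (x.reorder σ) = ((Equiv.Perm.sign σ : ℤ) : ℚ) • g x) :
    CubeChain K n s k →ₗ[ℚ] M :=
  (chainRel K n s k).liftQ (Finsupp.linearCombination ℚ g) <| by
    unfold chainRel
    refine Submodule.span_le.2 ?_
    rintro z (⟨x, y, h, rfl⟩ | ⟨x, σ, rfl⟩)
    · simp [h1 x y h]
    · simp [h2 x σ]

lemma lift_mk {M : Type*} [AddCommGroup M] [Module ℚ M] (g : GraphCube K n s k → M) (h1 h2)
    (x : GraphCube K n s k) : lift g h1 h2 (mk x) = g x := by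
  unfold lift mk
  refine (Submodule.liftQ_apply _ _ _).trans ?_
  simp

lemma hom_ext {M : Type*} [AddCommGroup M] [Module ℚ M] {f g : CubeChain K n s k →ₗ[ℚ] M}
    (h : ∀ x, f (mk x) = g (mk x)) : f = g := by
  refine Submodule.linearMap_qext _ (Finsupp.lhom_ext' fun x => LinearMap.ext_ring (h x))

/-! Compatibility of the faces with isomorphisms and reorderings. -/

lemma sub_iso {l : ℕ} {x y : GraphCube K n s l} (f : Fin k ↪ Fin l) (h : x.Iso y) :
    (x.sub f).Iso (y.sub f) := by
  obtain ⟨φ, ψ, h1, h2, h3, h4⟩ := h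
  exact ⟨φ, ψ, h1, h2, fun j => h3 _, h4⟩

lemma contractAt_congr {G : LegGraph s} {adm : G.Admissible} {rank_eq : G.rank = n}
    {col : G.E → K} {e e' : G.E} {F F' : Fin k → G.E} {inj ne forest inj' ne' forest'}
    (he : e = e') (hF : F = F') :
    GraphCube.contractAt G adm rank_eq col e F inj ne forest =
      GraphCube.contractAt G adm rank_eq col e' F' inj' ne' forest' := by
  subst he hF
  rfl

lemma con_iso {x y : GraphCube K n s (k + 1)} (i : Fin (k + 1)) (h : x.Iso y) :
    (x.con i).Iso (y.con i) := by
  obtain ⟨φ, ψ, h1, h2, h3, h4⟩ := h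
  let φ' : (x.G.contract (x.F i)).V ≃ (y.G.contract (y.F i)).V := by
    refine Quot.congr φ ?_
    intro u v
    constructor
    · rintro ⟨e, rfl, h⟩
      exact ⟨_, rfl, by rw [← h3, h1, h, Sym2.map_mk]⟩
    · rintro ⟨e, rfl, h⟩
      refine ⟨_, rfl, Sym2.map.injective φ.injective ?_⟩
      rw [← h1, h3, h, Sym2.map_mk]
  refine ⟨φ', ψ.subtypeEquiv fun a => ?_, ?_, ?_, ?_, ?_⟩
  · rw [← h3, Ne, Ne, ψ.apply_eq_iff_eq]
  · rintro ⟨a, ha⟩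
    change (y.G.ends (ψ a)).map (Quot.mk _) = Sym2.map φ' ((x.G.ends a).map (Quot.mk _))
    rw [h1, Sym2.map_map, Sym2.map_map]
    rfl
  · intro j
    exact congrArg (Quot.mk _) (h2 j)
  · intro j
    exact Subtype.ext (h3 _)
  · rintro ⟨a, ha⟩
    exact h4 a

/-- The order of the remaining forest edges after deleting the `i`-th one from a reordering. -/
lemma exists_perm (σ : Equiv.Perm (Fin (k + 1))) (i : Fin (k + 1)) :
    ∃ τ : Equiv.Perm (Fin k), (∀ j, σ (i.succAbove j) = (σ i).succAbove (τ j)) ∧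
      (-1 : ℚ) ^ (i : ℕ) * ((Equiv.Perm.sign τ : ℤ) : ℚ) =
        ((Equiv.Perm.sign σ : ℤ) : ℚ) * (-1) ^ (σ i : ℕ) := by
  let ρ : Equiv.Perm (Fin (k + 1)) := i.cycleRange.symm.trans (σ.trans (σ i).cycleRange)
  have hρ0 : ρ 0 = 0 := by simp [ρ]
  obtain ⟨⟨p, τ⟩, hτ⟩ := Equiv.Perm.decomposeFin.symm.surjective ρ
  have hp : p = 0 := by
    rw [← hρ0, ← hτ]
    simp
  subst hp
  refine ⟨τ, fun j => ?_, ?_⟩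
  · have h1 : ρ j.succ = (τ j).succ := by
      rw [← hτ]
      simp
    have h2 : ρ j.succ = (σ i).cycleRange (σ (i.succAbove j)) := by simp [ρ]
    rw [h2] at h1
    apply (σ i).cycleRange.injective
    rw [h1, Fin.cycleRange_succAbove]
  · have h1 : Equiv.Perm.sign ρ = Equiv.Perm.sign τ := by
      rw [← hτ]
      simp
    have h2 : Equiv.Perm.sign ρ =
        (-1) ^ (σ i : ℕ) * (Equiv.Perm.sign σ * (-1) ^ (i : ℕ)) := by
      simp [ρ, Equiv.Perm.sign_trans, Fin.sign_cycleRange]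
      rw [mul_assoc]
    rw [← h1, h2]
    push_cast
    have h3 : ((-1 : ℚ) ^ (i : ℕ)) * (-1) ^ (i : ℕ) = 1 := by
      rw [← mul_pow]
      simp
    linear_combination ((-1 : ℚ) ^ (σ i : ℕ) * ((Equiv.Perm.sign σ : ℤ) : ℚ)) * h3

lemma del_reorder (x : GraphCube K n s (k + 1)) (σ : Equiv.Perm (Fin (k + 1)))
    (i : Fin (k + 1)) (τ : Equiv.Perm (Fin k))
    (h : ∀ j, σ (i.succAbove j) = (σ i).succAbove (τ j)) :
    (x.reorder σ).del i = (x.del (σ i)).reorder τ := by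
  unfold GraphCube.reorder GraphCube.del GraphCube.sub
  congr 1
  funext j
  simp [h]

lemma con_reorder (x : GraphCube K n s (k + 1)) (σ : Equiv.Perm (Fin (k + 1)))
    (i : Fin (k + 1)) (τ : Equiv.Perm (Fin k))
    (h : ∀ j, σ (i.succAbove j) = (σ i).succAbove (τ j)) :
    (x.reorder σ).con i = (x.con (σ i)).reorder τ := by
  unfold GraphCube.reorder GraphCube.con GraphCube.sub GraphCube.contractAt
  congr 1
  funext j
  exact Subtype.ext (congrArg x.F (h j))

/-- The boundary of a single cube. -/
noncomputable def bdryCube (x : GraphCube K n s (k + 1)) : CubeChain K n s k :=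
  ∑ i : Fin (k + 1), (-1 : ℚ) ^ (i : ℕ) • (mk (x.del i) - mk (x.con i))

/-- The boundary operator
`(G, F, c) ↦ ∑ i, (-1) ^ i ((G, F \ e_i, c) - (G / e_i, F / e_i, c restricted))`, where the
edges `e_i` of `F` are numbered starting with `0`. -/
noncomputable def bdry (K : Type) (n s k : ℕ) : CubeChain K n s (k + 1) →ₗ[ℚ] CubeChain K n s k :=
  lift bdryCube
    (by
      intro x y h
      unfold bdryCube
      refine Finset.sum_congr rfl fun i _ => ?_
      have h1 : mk (x.del i) = mk (y.del i) := mk_eq_of_iso (sub_iso i.succAboveEmb h)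
      rw [h1, mk_eq_of_iso (con_iso i h)])
    (by
      intro x σ
      unfold bdryCube
      rw [Finset.smul_sum,
        ← Equiv.sum_comp σ (fun i => _ • (-1 : ℚ) ^ (i : ℕ) • (mk (x.del i) - mk (x.con i)))]
      refine Finset.sum_congr rfl fun i _ => ?_
      obtain ⟨τ, h1, h2⟩ := exists_perm σ i
      rw [del_reorder x σ i τ h1, con_reorder x σ i τ h1, mk_reorder, mk_reorder, ← smul_sub,
        smul_smul, h2, ← smul_smul])

lemma bdry_mk (x : GraphCube K n s (k + 1)) : bdry K n s k (mk x) = bdryCube x := lift_mk _ _ _ x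

lemma con_con (x : GraphCube K n s (k + 2)) (i i' : Fin (k + 2)) (j j' : Fin (k + 1))
    (h1 : i.succAbove j = i') (h2 : i'.succAbove j' = i)
    (h3 : ∀ l, i.succAbove (j.succAbove l) = i'.succAbove (j'.succAbove l)) :
    ((x.con i).con j).Iso ((x.con i').con j') := by
  have hd : ∀ (G : LegGraph s) (e e' : G.E), ∀ u v, G.adj {e} u v →
      ∀ h : e ≠ e', (Quot.mk _ (Quot.mk _ u) :
        ((G.contract e').contract ⟨e, h⟩).V) = Quot.mk _ (Quot.mk _ v) := by
    rintro G e e' u v ⟨_, rfl, h⟩ hne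
    refine Quot.sound ⟨_, rfl, ?_⟩
    change (G.ends _).map _ = _
    rw [h, Sym2.map_mk]
  have hV : ∀ (G : LegGraph s) (e e' : G.E) (h : e ≠ e') (h' : e' ≠ e),
      ∃ f : ((G.contract e).contract ⟨e', h'⟩).V → ((G.contract e').contract ⟨e, h⟩).V,
        ∀ v, f (Quot.mk _ (Quot.mk _ v)) = Quot.mk _ (Quot.mk _ v) := by
    intro G e e' h h'
    let g : (G.contract e).V → ((G.contract e').contract ⟨e, h⟩).V :=
      Quot.lift (fun v => Quot.mk _ (Quot.mk _ v)) fun u v huv => hd G e e' u v huv h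
    refine ⟨Quot.lift g ?_, fun v => rfl⟩
    rintro ⟨u⟩ ⟨v⟩ ⟨_, rfl, huv⟩
    obtain ⟨a, b, hab⟩ : ∃ a b, G.ends e' = s(a, b) := by
      induction h : G.ends e' using Sym2.ind with
      | _ a b => exact ⟨a, b, rfl⟩
    have hg : g (Quot.mk _ a) = g (Quot.mk _ b) :=
      congrArg (Quot.mk _) (G.comp_sound (Set.mem_singleton _) hab)
    change (G.ends e').map (Quot.mk _) = _ at huv
    rw [hab, Sym2.map_mk] at huv
    rcases Sym2.eq_iff.1 huv with ⟨h1, h2⟩ | ⟨h1, h2⟩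
    · rw [← h1, ← h2]
      exact hg
    · rw [← h1, ← h2]
      exact hg.symm
  have hp : ∀ (G : LegGraph s) (e e' : G.E) (h : e ≠ e') (h' : e' ≠ e),
      ∃ φ : ((G.contract e).contract ⟨e', h'⟩).V ≃ ((G.contract e').contract ⟨e, h⟩).V,
        ∀ v, φ (Quot.mk _ (Quot.mk _ v)) = Quot.mk _ (Quot.mk _ v) := by
    intro G e e' h h'
    obtain ⟨f, hf⟩ := hV G e e' h h'
    obtain ⟨g, hg⟩ := hV G e' e h' h
    refine ⟨⟨f, g, ?_, ?_⟩, hf⟩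
    · rintro ⟨⟨v⟩⟩
      rw [hf, hg]
    · rintro ⟨⟨v⟩⟩
      rw [hg, hf]
  subst h1
  have hne : x.F i ≠ x.F (i.succAbove j) := fun h => Fin.succAbove_ne _ _ (x.inj h).symm
  obtain ⟨φ, hφ⟩ := hp x.G (x.F i) (x.F (i.succAbove j)) hne hne.symm
  -- the second contraction on the right, written with the edge `F i`
  have hright : ((x.con (i.succAbove j)).con j') =
      GraphCube.contractAt (x.con (i.succAbove j)).G (x.con (i.succAbove j)).adm
        (x.con (i.succAbove j)).rank_eq (x.con (i.succAbove j)).col ⟨x.F i, hne⟩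
        ((x.con (i.succAbove j)).F ∘ j'.succAbove)
        ((x.con (i.succAbove j)).inj.comp Fin.succAbove_right_injective)
        (fun l h => Fin.succAbove_ne _ _ ((x.con (i.succAbove j)).inj (h.trans
          (Subtype.ext (congrArg x.F h2.symm)))))
        ((x.con (i.succAbove j)).forest.subset (Set.insert_subset
          ⟨j', Subtype.ext (congrArg x.F h2)⟩ (Set.range_comp_subset_range _ _))) :=
    contractAt_congr (Subtype.ext (congrArg x.F h2)) rfl
  rw [hright]
  refine ⟨φ, ⟨fun a => ⟨⟨a.1.1, fun h => a.2 (Subtype.ext h)⟩, fun h =>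
      a.1.2 (congrArg Subtype.val h)⟩, fun a => ⟨⟨a.1.1, fun h => a.2 (Subtype.ext h)⟩, fun h =>
      a.1.2 (congrArg Subtype.val h)⟩, fun _ => rfl, fun _ => rfl⟩, ?_, ?_, ?_, ?_⟩
  · rintro ⟨⟨a, ha⟩, ha'⟩
    change Sym2.map (Quot.mk _) (Sym2.map (Quot.mk _) (x.G.ends a)) =
      Sym2.map φ (Sym2.map (Quot.mk _) (Sym2.map (Quot.mk _) (x.G.ends a)))
    rw [Sym2.map_map, Sym2.map_map, Sym2.map_map]
    congr 1
    funext v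
    exact (hφ v).symm
  · intro l
    exact (hφ _).symm
  · intro l
    exact Subtype.ext (Subtype.ext (congrArg x.F (h3 l)))
  · intro a
    rfl

lemma sum_sum_anti {M : Type*} [AddCommGroup M] [Module ℚ M]
    (A B : Fin (k + 2) → Fin (k + 1) → M)
    (h : ∀ i j, A i j = B (i.succAbove j) (j.predAbove i)) :
    ∑ i : Fin (k + 2), ∑ j : Fin (k + 1), (-1 : ℚ) ^ ((i : ℕ) + (j : ℕ)) • A i j +
      ∑ i : Fin (k + 2), ∑ j : Fin (k + 1), (-1 : ℚ) ^ ((i : ℕ) + (j : ℕ)) • B i j = 0 := by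
  let σ : Fin (k + 2) × Fin (k + 1) ≃ Fin (k + 2) × Fin (k + 1) :=
    { toFun := fun p => (p.1.succAbove p.2, p.2.predAbove p.1)
      invFun := fun p => (p.1.succAbove p.2, p.2.predAbove p.1)
      left_inv := fun p => Prod.ext (Fin.succAbove_succAbove_predAbove _ _)
        (Fin.predAbove_predAbove_succAbove _ _)
      right_inv := fun p => Prod.ext (Fin.succAbove_succAbove_predAbove _ _)
        (Fin.predAbove_predAbove_succAbove _ _) }
  rw [← Fintype.sum_prod_type' (f := fun (i : Fin (k + 2)) (j : Fin (k + 1)) =>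
      (-1 : ℚ) ^ ((i : ℕ) + (j : ℕ)) • A i j),
    ← Fintype.sum_prod_type' (f := fun (i : Fin (k + 2)) (j : Fin (k + 1)) =>
      (-1 : ℚ) ^ ((i : ℕ) + (j : ℕ)) • B i j),
    ← Equiv.sum_comp σ (fun p => (-1 : ℚ) ^ ((p.1 : ℕ) + (p.2 : ℕ)) • B p.1 p.2),
    ← Finset.sum_add_distrib]
  refine Finset.sum_eq_zero fun p _ => ?_
  change _ + (-1 : ℚ) ^ ((p.1.succAbove p.2 : ℕ) + (p.2.predAbove p.1 : ℕ)) • B _ _ = 0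
  rw [Fin.neg_one_pow_succAbove_add_predAbove, h]
  simp [σ]

lemma bdry_bdry : bdry K n s k ∘ₗ bdry K n s (k + 1) = 0 := by
  refine hom_ext fun x => ?_
  have hs : ∀ (i : Fin (k + 2)) (j : Fin (k + 1)) (l : Fin k),
      i.succAbove (j.succAbove l) =
        (i.succAbove j).succAbove ((j.predAbove i).succAbove l) := fun i j l =>
    (Fin.succAbove_succAbove_succAbove_predAbove i j l).symm
  have hb := Fin.succAbove_succAbove_predAbove (n := k + 1)
  have hdd := sum_sum_anti (fun i j => mk ((x.del i).del j)) (fun i j => mk ((x.del i).del j))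
    (fun i j => by
      congr 1
      unfold GraphCube.del GraphCube.sub
      congr 1
      funext l
      exact congrArg x.F (hs i j l))
  have hcc := sum_sum_anti (fun i j => mk ((x.con i).con j)) (fun i j => mk ((x.con i).con j))
    (fun i j => mk_eq_of_iso (con_con x i _ j _ rfl (hb i j) (hs i j)))
  have hdc := sum_sum_anti (fun i j => mk ((x.con i).del j)) (fun i j => mk ((x.del i).con j))
    (fun i j => by
      congr 1
      refine Eq.trans (b := GraphCube.contractAt x.G x.adm x.rank_eq x.col (x.F i)
        (x.F ∘ i.succAbove ∘ j.succAbove)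
        (x.inj.comp (Fin.succAbove_right_injective.comp Fin.succAbove_right_injective))
        (fun _ h => Fin.succAbove_ne _ _ (x.inj h))
        (x.forest.subset (Set.insert_subset (Set.mem_range_self _)
          (Set.range_comp_subset_range _ _)))) rfl ?_
      exact contractAt_congr (congrArg x.F (hb i j).symm)
        (funext fun l => congrArg x.F (hs i j l)))
  have key : bdry K n s k (bdryCube x) =
      ∑ i : Fin (k + 2), ∑ j : Fin (k + 1), (-1 : ℚ) ^ (i + j : ℕ) • mk ((x.del i).del j)
      - ∑ i : Fin (k + 2), ∑ j : Fin (k + 1), (-1 : ℚ) ^ (i + j : ℕ) • mk ((x.del i).con j)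
      - (∑ i : Fin (k + 2), ∑ j : Fin (k + 1), (-1 : ℚ) ^ (i + j : ℕ) • mk ((x.con i).del j)
      - ∑ i : Fin (k + 2), ∑ j : Fin (k + 1), (-1 : ℚ) ^ (i + j : ℕ) • mk ((x.con i).con j)) := by
    unfold bdryCube
    simp only [map_sum, map_smul, map_sub, bdry_mk, ← Finset.sum_sub_distrib]
    refine Finset.sum_congr rfl fun i _ => ?_
    unfold bdryCube
    rw [← Finset.sum_sub_distrib, Finset.smul_sum]
    refine Finset.sum_congr rfl fun j _ => ?_
    rw [pow_add, mul_smul, mul_smul, mul_smul, mul_smul]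
    simp only [smul_sub]
  have two : ∀ z : CubeChain K n s k, z + z = 0 → z = 0 := fun z hz => by
    rw [← two_smul ℚ z] at hz
    exact (smul_eq_zero.1 hz).resolve_left two_ne_zero
  have hdd0 := two _ hdd
  have hcc0 := two _ hcc
  rw [LinearMap.comp_apply, bdry_mk, key, hdd0, hcc0, eq_neg_of_add_eq_zero_left hdc]
  simp

end CubeChain

namespace CubeChain

variable {n s k : ℕ}

lemma recolor_iso {K L : Type} {x y : GraphCube K n s k} (c : x.G.E → L) (d : y.G.E → L)
    (h : ∃ (φ : x.G.V ≃ y.G.V) (ψ : x.G.E ≃ y.G.E),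
      (∀ e, y.G.ends (ψ e) = (x.G.ends e).map φ) ∧ (∀ i, y.G.leg i = φ (x.G.leg i)) ∧
      (∀ j, ψ (x.F j) = y.F j) ∧ (∀ e, d (ψ e) = c e)) :
    (x.recolor c).Iso (y.recolor d) := h

/-- The map `(G, F, c) ↦ (G, F)` on chains. -/
noncomputable def forget (m n s k : ℕ) : CubeChain (Fin m) n s k →ₗ[ℚ] CubeChain Unit n s k :=
  lift (fun x => mk (x.recolor fun _ => ()))
    (by
      rintro x y ⟨φ, ψ, h1, h2, h3, -⟩
      exact mk_eq_of_iso (recolor_iso _ _ ⟨φ, ψ, h1, h2, h3, fun _ => rfl⟩))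
    (fun x σ => mk_reorder (x.recolor fun _ => ()) σ)

lemma forget_mk {m : ℕ} (x : GraphCube (Fin m) n s k) :
    forget m n s k (mk x) = mk (x.recolor fun _ => ()) := lift_mk _ _ _ x

/-- The map `(G, F) ↦ ∑ c, m ^ (-|E(G)|) • (G, F, c)` on chains, the sum being over all
`m`-colorings `c` of the edges of `G`. -/
noncomputable def average (m n s k : ℕ) : CubeChain Unit n s k →ₗ[ℚ] CubeChain (Fin m) n s k :=
  lift (fun x => ∑ᶠ c : x.G.E → Fin m, (1 / (m : ℚ) ^ Nat.card x.G.E) • mk (x.recolor c))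
    (by
      rintro x y ⟨φ, ψ, h1, h2, h3, -⟩
      refine finsum_eq_of_bijective (fun c => c ∘ ψ.symm)
        (ψ.arrowCongr (Equiv.refl (Fin m))).bijective fun c => ?_
      rw [Nat.card_congr ψ]
      congr 1
      exact mk_eq_of_iso (recolor_iso _ _ ⟨φ, ψ, h1, h2, h3, fun e => by simp⟩))
    (by
      intro x σ
      rw [smul_finsum]
      refine finsum_congr fun c => ?_
      rw [smul_comm, ← mk_reorder]
      rfl)

lemma average_mk {m : ℕ} (x : GraphCube Unit n s k) :
    average m n s k (mk x) =
      ∑ᶠ c : x.G.E → Fin m, (1 / (m : ℚ) ^ Nat.card x.G.E) • mk (x.recolor c) := lift_mk _ _ _ x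

lemma bdry_forget (m : ℕ) :
    bdry Unit n s k ∘ₗ forget m n s (k + 1) = forget m n s k ∘ₗ bdry (Fin m) n s k := by
  refine hom_ext fun x => ?_
  rw [LinearMap.comp_apply, LinearMap.comp_apply, forget_mk, bdry_mk, bdry_mk]
  unfold bdryCube
  simp only [map_sum, map_smul, map_sub, forget_mk]
  rfl

lemma average_aux {M : Type*} [AddCommGroup M] [Module ℚ M] (m : ℕ) [NeZero m] {E : Type}
    [Finite E] (e : E) (g : ({a : E // a ≠ e} → Fin m) → M) :
    ∑ᶠ c : E → Fin m, (1 / (m : ℚ) ^ Nat.card E) • g (fun a => c a.1) =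
      ∑ᶠ c, (1 / (m : ℚ) ^ Nat.card {a : E // a ≠ e}) • g c := by
  classical
  have := Fintype.ofFinite E
  have hcard : Nat.card E = Nat.card {a : E // a ≠ e} + 1 := by
    rw [← Nat.card_congr (Equiv.optionSubtypeNe e), Finite.card_option]
  rw [finsum_eq_sum_of_fintype, finsum_eq_sum_of_fintype,
    ← Equiv.sum_comp (Equiv.funSplitAt e (Fin m)).symm, Fintype.sum_prod_type]
  have hm : (m : ℚ) ≠ 0 := Nat.cast_ne_zero.2 (NeZero.ne m)
  have h : ∀ (p : Fin m) (c : {a : E // a ≠ e} → Fin m),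
      (fun a : {a : E // a ≠ e} => (Equiv.funSplitAt e (Fin m)).symm (p, c) a.1) = c := by
    intro p c
    funext a
    simp [Equiv.funSplitAt, Equiv.piSplitAt, a.2]
  simp only [h]
  rw [Finset.sum_const, Finset.card_univ, Fintype.card_fin, ← Nat.cast_smul_eq_nsmul ℚ,
    Finset.smul_sum]
  refine Finset.sum_congr rfl fun c _ => ?_
  rw [smul_smul, hcard, pow_succ]
  congr 1
  field_simp

lemma bdry_average (m : ℕ) [NeZero m] :
    bdry (Fin m) n s k ∘ₗ average m n s (k + 1) = average m n s k ∘ₗ bdry Unit n s k := by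
  refine hom_ext fun x => ?_
  rw [LinearMap.comp_apply, LinearMap.comp_apply, average_mk, bdry_mk]
  unfold bdryCube
  simp only [map_sum, map_smul, map_sub, average_mk]
  have := Fintype.ofFinite (x.G.E → Fin m)
  have h1 : ∀ i, (∑ᶠ c : (x.del i).G.E → Fin m,
      (1 / (m : ℚ) ^ Nat.card (x.del i).G.E) • mk ((x.del i).recolor c)) =
      ∑ c : x.G.E → Fin m, (1 / (m : ℚ) ^ Nat.card x.G.E) • mk ((x.recolor c).del i) :=
    fun i => @finsum_eq_sum_of_fintype _ _ _ this _
  have h2 : ∀ i, (∑ᶠ c : (x.con i).G.E → Fin m,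
      (1 / (m : ℚ) ^ Nat.card (x.con i).G.E) • mk ((x.con i).recolor c)) =
      ∑ c : x.G.E → Fin m, (1 / (m : ℚ) ^ Nat.card x.G.E) • mk ((x.recolor c).con i) :=
    fun i => (average_aux m (x.F i) fun c => mk ((x.con i).recolor c)).symm.trans
      (finsum_eq_sum_of_fintype _)
  simp only [h1, h2]
  rw [finsum_eq_sum_of_fintype]
  simp only [map_sum, map_smul, bdry_mk]
  unfold bdryCube
  simp only [Finset.smul_sum, ← Finset.sum_sub_distrib]
  rw [Finset.sum_comm]
  refine Finset.sum_congr rfl fun i _ => Finset.sum_congr rfl fun c _ => ?_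
  rw [smul_comm, smul_sub]

end CubeChain

/-- The rational cubical chain complex of admissible graphs of rank `n` with `s` legs whose edges
are colored by elements of `K`. -/
noncomputable def cubicalComplex (K : Type) (n s : ℕ) : ChainComplex (ModuleCat.{1} ℚ) ℕ :=
  ChainComplex.of (fun k => ModuleCat.of ℚ (CubeChain K n s k))
    (fun k => ModuleCat.ofHom (CubeChain.bdry K n s k))
    (fun k => by
      rw [← ModuleCat.ofHom_comp, CubeChain.bdry_bdry]
      rfl)

lemma cubicalComplex_d (K : Type) (n s k : ℕ) :
    (cubicalComplex K n s).d (k + 1) k = ModuleCat.ofHom (CubeChain.bdry K n s k) :=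
  ChainComplex.of_d (fun k => ModuleCat.of ℚ (CubeChain K n s k))
    (fun k => ModuleCat.ofHom (CubeChain.bdry K n s k)) k

/-- The rational cubical chain complex of the moduli space of `m`-colored graphs of rank `n` with
`s` legs. -/
noncomputable abbrev MCG (m n s : ℕ) : ChainComplex (ModuleCat.{1} ℚ) ℕ :=
  cubicalComplex (Fin m) n s

/-- The rational cubical chain complex of the moduli space of (uncolored) graphs of rank `n` with
`s` legs; a coloring by the one-point type `Unit` carries no information. -/
noncomputable abbrev MG (n s : ℕ) : ChainComplex (ModuleCat.{1} ℚ) ℕ :=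
  cubicalComplex Unit n s

/-- The chain map that forgets the coloring. -/
noncomputable def forgetColoring (m n s : ℕ) : MCG m n s ⟶ MG n s :=
  ChainComplex.ofHom (fun k => ModuleCat.ofHom (CubeChain.forget m n s k)) fun k => by
    rw [cubicalComplex_d, cubicalComplex_d]
    exact congrArg ModuleCat.ofHom (CubeChain.bdry_forget m)

/-- The chain map that averages over all colorings. -/
noncomputable def averageColorings (m n s : ℕ) [NeZero m] : MG n s ⟶ MCG m n s :=
  ChainComplex.ofHom (fun k => ModuleCat.ofHom (CubeChain.average m n s k)) fun k => by
    rw [cubicalComplex_d, cubicalComplex_d]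
    exact congrArg ModuleCat.ofHom (CubeChain.bdry_average m)

/-! The theorem is an averaging argument, and it already holds on chains. Fix a cube `(G, F)` with
edge set `E`. There are `m ^ |E|` colorings of `E`, each carries the weight `m ^ (-|E|)`, and
forgetting the coloring sends every term of the average back to `(G, F)`. So forgetting after
averaging is multiplication by `m ^ |E| / m ^ |E| = 1`, which is `forget_comp_average`.

The weight also makes averaging compatible with the boundary. Deleting an edge from the forest does
not change `E`; contracting an edge lowers `|E|` by one, and each coloring of `G / e` extends to `G`
in exactly `m` ways. This is `average_aux`, used in `bdry_average`. Forgetting commutes with both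
kinds of faces for trivial reasons (`bdry_forget`).

Functoriality of homology turns the chain identity into a splitting: averaging is a section of
forgetting on homology, so it is injective and forgetting is surjective. No homology group has to be
computed.

For the comparison of dimensions, a single color carries no information: when `m = 1` the opposite
composite is the identity as well (`average_comp_forget_one`), so the one-colored complex is
isomorphic to the uncolored one. Following this identification by averaging over `m` colors embeds
the homology of `X^1_s` in that of `X^m_s`. -/

namespace CubeChain

variable {n s k : ℕ}

/-! ### The two composites, degree by degree on chains -/

/-- Averaging over all colorings and then forgetting the coloring is the identity on chains. -/
lemma forget_comp_average (m : ℕ) [NeZero m] :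
    forget m n s k ∘ₗ average m n s k = LinearMap.id := by
  refine hom_ext fun x => ?_
  have := Fintype.ofFinite (x.G.E → Fin m)
  -- Here `m ≥ 1` is essential: for `m = 0` a graph with at least one edge has no coloring, and its
  -- average is zero.
  have hm : (m : ℚ) ^ Nat.card x.G.E ≠ 0 := pow_ne_zero _ (Nat.cast_ne_zero.2 (NeZero.ne m))
  -- Every summand has the same image. Recoloring by `Unit` gives back `x` definitionally, since `x`
  -- is itself colored by `Unit`.
  have hforget : ∀ c : x.G.E → Fin m, forget m n s k (mk (x.recolor c)) = mk x :=
    fun c => forget_mk (x.recolor c)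
  rw [LinearMap.comp_apply, average_mk, finsum_eq_sum_of_fintype]
  simp only [map_sum, map_smul, hforget]
  -- The number of equal summands is `m ^ |E|`, the reciprocal of the weight. Passing from
  -- `Fintype.card` to `Nat.card` matches the form of the weight in `average`.
  rw [Finset.sum_const, Finset.card_univ, ← Nat.card_eq_fintype_card, Nat.card_fun, Nat.card_fin,
    ← Nat.cast_smul_eq_nsmul ℚ, smul_smul, Nat.cast_pow, mul_one_div_cancel hm, one_smul]
  rfl

/-- With a single color, forgetting the coloring loses nothing. -/
lemma average_comp_forget_one : average 1 n s k ∘ₗ forget 1 n s k = LinearMap.id := by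
  refine hom_ext fun x => ?_
  have hcol : x.recolor x.col = x := rfl
  rw [LinearMap.comp_apply, forget_mk, average_mk]
  -- Colorings by `Fin 1` form a subsingleton, so the average has only one term, the original
  -- coloring. For more colors this composite is merely the projection onto color-averaged chains.
  refine (finsum_eq_single _ x.col fun c hc => absurd (Subsingleton.elim c x.col) hc).trans ?_
  change (1 / ((1 : ℕ) : ℚ) ^ Nat.card x.G.E) • mk (x.recolor x.col) = mk x
  rw [hcol, Nat.cast_one, one_pow, div_one, one_smul]

end CubeChain

/-! ### From chains to complexes and homology -/

lemma averageColorings_comp_forgetColoring (m n s : ℕ) [NeZero m] :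
    averageColorings m n s ≫ forgetColoring m n s = 𝟙 (MG n s) := by
  refine HomologicalComplex.hom_ext _ _ fun k => ?_
  -- In each degree the composite of morphisms is, by definition, the composite of the underlying
  -- linear maps in reversed order.
  exact congrArg ModuleCat.ofHom (CubeChain.forget_comp_average m)

lemma forgetColoring_comp_averageColorings_one (n s : ℕ) :
    forgetColoring 1 n s ≫ averageColorings 1 n s = 𝟙 (MCG 1 n s) := by
  refine HomologicalComplex.hom_ext _ _ fun k => ?_
  exact congrArg ModuleCat.ofHom CubeChain.average_comp_forget_one

/-- Homology is a functor, so the section on chain complexes remains a section on homology. -/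
lemma homologyMap_averageColorings_comp_forgetColoring (m n s k : ℕ) [NeZero m] :
    HomologicalComplex.homologyMap (averageColorings m n s) k ≫
      HomologicalComplex.homologyMap (forgetColoring m n s) k = 𝟙 ((MG n s).homology k) := by
  rw [← HomologicalComplex.homologyMap_comp, averageColorings_comp_forgetColoring,
    HomologicalComplex.homologyMap_id]

lemma homologyMap_forgetColoring_comp_averageColorings_one (n s k : ℕ) :
    HomologicalComplex.homologyMap (forgetColoring 1 n s) k ≫
      HomologicalComplex.homologyMap (averageColorings 1 n s) k = 𝟙 ((MCG 1 n s).homology k) := by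
  rw [← HomologicalComplex.homologyMap_comp, forgetColoring_comp_averageColorings_one,
    HomologicalComplex.homologyMap_id]

/-- Passes from a categorical splitting to elements, where surjectivity of `g` and injectivity of
`f` are both immediate. -/
lemma ModuleCat.leftInverse_of_comp_eq_id {R : Type*} [Ring R] {M N : ModuleCat R} {f : M ⟶ N}
    {g : N ⟶ M} (h : f ≫ g = 𝟙 M) : Function.LeftInverse g f :=
  fun x => congrArg (fun φ : M ⟶ M => φ x) h

/-! ### The splitting and the comparison of dimensions -/

theorem mainTheorem7 (m n s : ℕ) [NeZero m] :
    (∀ k : ℕ,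
      HomologicalComplex.homologyMap (averageColorings m n s) k ≫
          HomologicalComplex.homologyMap (forgetColoring m n s) k =
        𝟙 ((MG n s).homology k) ∧
      Function.Surjective (HomologicalComplex.homologyMap (forgetColoring m n s) k) ∧
      Function.Injective (HomologicalComplex.homologyMap (averageColorings m n s) k)) ∧
    (∀ k : ℕ,
      Module.rank ℚ ((MCG 1 1 s).homology k) ≤ Module.rank ℚ ((MCG m 1 s).homology k)) := by
  refine ⟨fun k => ?_, fun k => ?_⟩
  · have h := homologyMap_averageColorings_comp_forgetColoring m n s k
    have hinv := ModuleCat.leftInverse_of_comp_eq_id h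
    exact ⟨h, hinv.surjective, hinv.injective⟩
  · have h1 := (ModuleCat.leftInverse_of_comp_eq_id
      (homologyMap_forgetColoring_comp_averageColorings_one 1 s k)).injective
    have h2 := (ModuleCat.leftInverse_of_comp_eq_id
      (homologyMap_averageColorings_comp_forgetColoring m 1 s k)).injective
    -- `Module.rank` is a cardinal, so an injection suffices and no finiteness of the homology is
    -- needed.
    exact LinearMap.rank_le_of_injective
      ((HomologicalComplex.homologyMap (averageColorings m 1 s) k).hom ∘ₗ
        (HomologicalComplex.homologyMap (forgetColoring 1 1 s) k).hom) (h2.comp h1)
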